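/- Let $(L_k)_{k\ge 1}$ be a sequence of independent real random variables on a probability space, each with the standard Laplace distribution, i.e. with density $\tfrac12 e^{-|x|}$, $x\in\mathbb{R}$. Then the series $$L=\sum_{k=1}^{\infty}\frac{L_k}{2\pi k}$$ converges almost surely (its partial sums converge almost surely to a real limit), and its sum $L$ follows a logistic distribution (the one with location $0$ and scale $\tfrac1{2\pi}$, where the logistic distribution with location $m$ and scale $s>0$ has density $\frac{e^{-(x-m)/s}}{s\,(1+e^{-(x-m)/s})^{2}}$), that is, $L$ has density $$f_L(x)=\frac{\pi}{2}\,\operatorname{sech}^2(\pi x),\qquad x\in\mathbb{R},$$ with respect to Lebesgue measure, where $\operatorname{sech}=1/\cosh$. -/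

import Mathlib

open MeasureTheory ProbabilityTheory Filter Topology

/-- The standard Laplace distribution on `ℝ`, with density `(1/2) exp (-|x|)`. -/
noncomputable def stdLaplaceMeasure : Measure ℝ :=
  volume.withDensity fun x => ENNReal.ofReal ((1 / 2) * Real.exp (-|x|))

/-- The density `exp (-(x - m)/s) / (s (1 + exp (-(x - m)/s))²)` of the logistic distribution
with location `m` and scale `s > 0`. -/
noncomputable def logisticDensity (m s x : ℝ) : ℝ :=
  Real.exp (-(x - m) / s) / (s * (1 + Real.exp (-(x - m) / s)) ^ 2)

/-- The logistic distribution with location `m` and scale `s > 0`. -/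
noncomputable def logisticMeasure (m s : ℝ) : Measure ℝ :=
  volume.withDensity fun x => ENNReal.ofReal (logisticDensity m s x)

/-- The hyperbolic secant. -/
noncomputable def sech (x : ℝ) : ℝ := 1 / Real.cosh x

/-- The `n`-th partial sum `∑_{k = 1}^{n} L_k / (2 π k)`, where the sequence `L_1, L_2, …` is
`X 0, X 1, …`, that is, `L_k = X (k - 1)`. -/
noncomputable def partialSumL {Ω : Type*} (X : ℕ → Ω → ℝ) (n : ℕ) (ω : Ω) : ℝ :=
  ∑ k ∈ Finset.range n, X k ω / (2 * Real.pi * ((k : ℝ) + 1))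

/-- The random variable `L` is the sum of the series `∑_{k ≥ 1} L_k / (2 π k)`, in the sense that
`P`-almost surely the partial sums converge to `L`. (The series does not converge absolutely,
so the unconditional sum `∑'` would not be meaningful here.) -/
def IsSeriesL {Ω : Type*} [MeasurableSpace Ω] (P : Measure Ω) (X : ℕ → Ω → ℝ) (L : Ω → ℝ) : Prop :=
  ∀ᵐ ω ∂P, Tendsto (fun n => partialSumL X n ω) atTop (𝓝 (L ω))

/-! Almost sure convergence is an L²-bounded martingale argument, since the variances are of order
1/k². For the law, put s = 1/(2π) and a = its. The partial sums have characteristic functions ∏ 1/(1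
+ (ts/k)²) = ∏ (1 - a²/k²)⁻¹, which tend to πa / sin(πa) by Euler's sine product. The logistic
characteristic function is the Beta integral B(1 + a, 1 - a) = Γ(1 + a)Γ(1 - a), equal to the same
quotient by the reflection formula. Characteristic functions determine the law. -/

/-- Kolmogorov's one-series theorem for measurable summands. -/
theorem exists_ae_tendsto_sum_of_stronglyMeasurable {Ω : Type*} [MeasurableSpace Ω]
    {P : Measure Ω} [IsProbabilityMeasure P] {Y : ℕ → Ω → ℝ} (hm : ∀ k, StronglyMeasurable (Y k))
    (hindep : iIndepFun Y P) (hL2 : ∀ k, MemLp (Y k) 2 P) (hmean : ∀ k, P[Y k] = 0)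
    (hvar : Summable fun k => Var[Y k; P]) :
    ∃ L : Ω → ℝ, ∀ᵐ ω ∂P, Tendsto (fun n => ∑ k ∈ Finset.range n, Y k ω) atTop (𝓝 (L ω)) := by
  have hint : ∀ k, Integrable (Y k) P := fun k => (hL2 k).integrable one_le_two
  -- With `n + 1` terms, `S n` is adapted to the natural filtration at time `n`, which already
  -- contains `Y n`.
  set S : ℕ → Ω → ℝ := fun n => ∑ k ∈ Finset.range (n + 1), Y k with hS
  have hSL2 : ∀ n, MemLp (S n) 2 P := fun n => memLp_finsetSum' _ fun k _ => hL2 k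
  have hSmean : ∀ n, P[S n] = 0 := fun n => by
    simp only [hS, Finset.sum_apply]
    rw [integral_finsetSum _ fun k _ => hint k]
    simp [hmean]
  have hmart : Martingale S (Filtration.natural Y hm) P := by
    refine martingale_of_condExp_sub_eq_zero_nat (fun n => ?_)
      (fun n => (hSL2 n).integrable one_le_two) fun n => ?_
    · refine Finset.stronglyMeasurable_sum _ fun k hk => ?_
      exact (Filtration.stronglyAdapted_natural hm k).mono
        ((Filtration.natural Y hm).mono (Finset.mem_range_succ_iff.mp hk))
    · have h : S (n + 1) - S n = Y (n + 1) := by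
        simp only [hS]
        rw [Finset.sum_range_succ _ (n + 1), add_sub_cancel_left]
      rw [h]
      filter_upwards [hindep.condExp_natural_ae_eq_of_lt hm n.lt_succ_self] with ω hω
      rw [hω, hmean]; rfl
  -- Variances add by independence, and |x| ≤ 1 + x² turns the L² bound into an L¹ bound.
  have hbdd : ∀ n, eLpNorm (S n) 1 P ≤ ((1 + ∑' k, Var[Y k; P]).toNNReal : NNReal) := fun n => by
    have hsq : Integrable (fun ω => S n ω ^ 2) P := (hSL2 n).integrable_sq
    have hvarS : ∫ ω, S n ω ^ 2 ∂P ≤ ∑' k, Var[Y k; P] := by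
      rw [← variance_of_integral_eq_zero (hSL2 n).aemeasurable (hSmean n),
        IndepFun.variance_sum (fun k _ => hL2 k) fun i _ j _ hij => hindep.indepFun hij]
      exact hvar.sum_le_tsum _ fun k _ => variance_nonneg _ _
    rw [eLpNorm_one_eq_lintegral_enorm,
      ← ofReal_integral_norm_eq_lintegral_enorm ((hSL2 n).integrable one_le_two)]
    refine ENNReal.ofReal_le_ofReal ?_
    calc ∫ ω, ‖S n ω‖ ∂P ≤ ∫ ω, (1 + S n ω ^ 2) ∂P :=
          integral_mono ((hSL2 n).integrable one_le_two).norm ((integrable_const 1).add hsq)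
            fun ω => by
              show ‖S n ω‖ ≤ 1 + S n ω ^ 2
              rw [Real.norm_eq_abs, ← sq_abs]
              nlinarith [sq_nonneg (|S n ω| - 1), abs_nonneg (S n ω)]
      _ = 1 + ∫ ω, S n ω ^ 2 ∂P := by
          rw [integral_add (integrable_const 1) hsq]; simp
      _ ≤ _ := by gcongr
  have hshift : ∀ ω l, Tendsto (fun n => S n ω) atTop (𝓝 l) ↔
      Tendsto (fun n => ∑ k ∈ Finset.range n, Y k ω) atTop (𝓝 l) := fun ω l => by
    rw [← tendsto_add_atTop_iff_nat (f := fun n => ∑ k ∈ Finset.range n, Y k ω) 1]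
    simp only [hS, Finset.sum_apply]
  have hlim := hmart.submartingale.ae_tendsto_limitProcess hbdd
  simp only [hshift] at hlim
  exact ⟨_, hlim⟩

/-- Kolmogorov's one-series theorem: a series of independent centred square-integrable random
variables with summable variances converges almost surely. -/
theorem exists_ae_tendsto_sum_of_summable_variance {Ω : Type*} [MeasurableSpace Ω]
    {P : Measure Ω} [IsProbabilityMeasure P] {Y : ℕ → Ω → ℝ}
    (hindep : iIndepFun Y P) (hL2 : ∀ k, MemLp (Y k) 2 P) (hmean : ∀ k, P[Y k] = 0)
    (hvar : Summable fun k => Var[Y k; P]) :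
    ∃ L : Ω → ℝ, ∀ᵐ ω ∂P, Tendsto (fun n => ∑ k ∈ Finset.range n, Y k ω) atTop (𝓝 (L ω)) := by
  have hae : ∀ k, Y k =ᵐ[P] (hL2 k).1.mk (Y k) := fun k => (hL2 k).1.ae_eq_mk
  obtain ⟨L, hL⟩ := exists_ae_tendsto_sum_of_stronglyMeasurable
    (fun k => (hL2 k).1.stronglyMeasurable_mk) (hindep.congr hae)
    (fun k => (memLp_congr_ae (hae k)).mp (hL2 k))
    (fun k => by rw [← integral_congr_ae (hae k), hmean k])
    (hvar.congr fun k => variance_congr (hae k))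
  refine ⟨L, ?_⟩
  filter_upwards [hL, ae_all_iff.mpr hae] with ω hω h
  simpa only [h] using hω

/-! ### The Laplace distribution: moments and characteristic function. -/

theorem measurable_stdLaplaceDensity :
    Measurable fun x : ℝ => ENNReal.ofReal ((1 / 2) * Real.exp (-|x|)) := by
  fun_prop

theorem memLp_id_stdLaplaceMeasure : MemLp id 2 stdLaplaceMeasure := by
  rw [memLp_two_iff_integrable_sq (by fun_prop), stdLaplaceMeasure,
    integrable_withDensity_iff measurable_stdLaplaceDensity (ae_of_all _ fun _ => ENNReal.ofReal_lt_top)]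
  have h : IntegrableOn (fun x : ℝ => Real.exp (-x) * x ^ 2) (Set.Ioi 0) := by
    have := Real.GammaIntegral_convergent (s := 3) (by norm_num)
    refine this.congr_fun (fun x _ => ?_) measurableSet_Ioi
    dsimp only
    rw [← Real.rpow_natCast]
    norm_num
  have hpos : IntegrableOn (fun x : ℝ => Real.exp (-|x|) * x ^ 2) (Set.Ioi 0) :=
    h.congr_fun (fun x hx => by simp only [abs_of_pos (Set.mem_Ioi.mp hx)]) measurableSet_Ioi
  have hneg : IntegrableOn (fun x : ℝ => Real.exp (-|x|) * x ^ 2) (Set.Iic 0) := by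
    rw [integrableOn_Iic_iff_integrableOn_Iio]
    rw [← neg_zero] at hpos
    simpa using hpos.comp_neg_Iio
  have h2 : Integrable (fun x : ℝ => Real.exp (-|x|) * x ^ 2) := by
    rw [← integrableOn_univ, ← Set.Iic_union_Ioi (a := (0 : ℝ))]
    exact hneg.union hpos
  refine (h2.const_mul (1 / 2)).congr (ae_of_all _ fun x => ?_)
  dsimp only [id]
  rw [ENNReal.toReal_ofReal (by positivity)]
  ring

theorem integral_id_stdLaplaceMeasure : ∫ x, x ∂stdLaplaceMeasure = 0 := by
  rw [stdLaplaceMeasure,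
    integral_withDensity_eq_integral_toReal_smul measurable_stdLaplaceDensity (ae_of_all _ fun _ => ENNReal.ofReal_lt_top)]
  -- The integrand is odd.
  have h := integral_neg_eq_self
    (fun x : ℝ => (ENNReal.ofReal ((1 / 2) * Real.exp (-|x|))).toReal • x) volume
  simp only [abs_neg, smul_neg, integral_neg] at h
  linarith

theorem charFun_stdLaplaceMeasure (t : ℝ) :
    charFun stdLaplaceMeasure t = 1 / (1 + (t : ℂ) ^ 2) := by
  rw [charFun_apply_real, stdLaplaceMeasure,
    integral_withDensity_eq_integral_toReal_smul measurable_stdLaplaceDensity (ae_of_all _ fun _ => ENNReal.ofReal_lt_top)]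
  have hp : ((1 : ℂ) + t * Complex.I).re = 1 := by simp
  have hn : (-1 + t * Complex.I : ℂ).re = -1 := by simp
  have hIic : ∀ x ∈ Set.Iic (0 : ℝ), (ENNReal.ofReal ((1 / 2) * Real.exp (-|x|))).toReal •
      Complex.exp (t * x * Complex.I) = (1 / 2 : ℂ) * Complex.exp ((1 + t * Complex.I) * x) := by
    intro x hx
    rw [ENNReal.toReal_ofReal (by positivity), abs_of_nonpos hx, Complex.real_smul]
    push_cast
    rw [mul_assoc, ← Complex.exp_add]
    ring_nf
  have hIoi : ∀ x ∈ Set.Ioi (0 : ℝ), (ENNReal.ofReal ((1 / 2) * Real.exp (-|x|))).toReal •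
      Complex.exp (t * x * Complex.I) = (1 / 2 : ℂ) * Complex.exp ((-1 + t * Complex.I) * x) := by
    intro x hx
    rw [ENNReal.toReal_ofReal (by positivity), abs_of_pos hx, Complex.real_smul]
    push_cast
    rw [mul_assoc, ← Complex.exp_add]
    ring_nf
  rw [← intervalIntegral.integral_Iic_add_Ioi (b := 0)
    (IntegrableOn.congr_fun ((integrableOn_exp_mul_complex_Iic (by rw [hp]; norm_num) 0).const_mul
      (1 / 2)) (fun x hx => (hIic x hx).symm) measurableSet_Iic)
    (IntegrableOn.congr_fun ((integrableOn_exp_mul_complex_Ioi (by rw [hn]; norm_num) 0).const_mul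
      (1 / 2)) (fun x hx => (hIoi x hx).symm) measurableSet_Ioi),
    setIntegral_congr_fun measurableSet_Iic hIic, setIntegral_congr_fun measurableSet_Ioi hIoi,
    integral_const_mul, integral_const_mul,
    integral_exp_mul_complex_Iic (by rw [hp]; norm_num),
    integral_exp_mul_complex_Ioi (by rw [hn]; norm_num)]
  have h1 : (1 + t * Complex.I : ℂ) ≠ 0 := fun h => by simp [h] at hp
  have h2 : (-1 + t * Complex.I : ℂ) ≠ 0 := fun h => by simp [h] at hn
  have h3 : (1 + (t : ℂ) ^ 2) = -((1 + t * Complex.I) * (-1 + t * Complex.I)) := by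
    ring_nf; simp
  rw [h3]
  simp only [Complex.ofReal_zero, mul_zero, Complex.exp_zero]
  field_simp
  ring

/-! ### The logistic distribution and Euler's product. -/

theorem hasDerivAt_sigmoid_div (s x : ℝ) :
    HasDerivAt (fun x => Real.sigmoid (x / s)) (logisticDensity 0 s x) x := by
  have h := (Real.hasDerivAt_sigmoid (x / s)).comp x ((hasDerivAt_id x).div_const s)
  convert! h using 1
  simp only [logisticDensity, Real.sigmoid_def, sub_zero, neg_div]
  have := Real.exp_pos (-(x / s))
  field_simp
  ring

theorem logisticDensity_nonneg {s : ℝ} (hs : 0 < s) (m x : ℝ) : 0 ≤ logisticDensity m s x := by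
  unfold logisticDensity
  positivity

theorem measurable_logisticDensity (m s : ℝ) : Measurable (logisticDensity m s) := by
  unfold logisticDensity
  fun_prop

theorem sigmoid_div_injective {s : ℝ} (hs : 0 < s) :
    Function.Injective fun x : ℝ => Real.sigmoid (x / s) := fun _ _ h =>
  (div_left_inj' hs.ne').mp (Real.sigmoid_injective h)

theorem image_sigmoid_div {s : ℝ} (hs : 0 < s) :
    (fun x : ℝ => Real.sigmoid (x / s)) '' Set.univ = Set.Ioo 0 1 := by
  rw [Set.image_univ, ← Real.range_sigmoid]
  exact (mul_right_surjective₀ (inv_ne_zero hs.ne')).range_comp Real.sigmoid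

theorem isProbabilityMeasure_logisticMeasure {s : ℝ} (hs : 0 < s) :
    IsProbabilityMeasure (logisticMeasure 0 s) := by
  have h := lintegral_image_eq_lintegral_abs_deriv_mul MeasurableSet.univ
    (fun x _ => (hasDerivAt_sigmoid_div s x).hasDerivWithinAt)
    (sigmoid_div_injective hs).injOn fun _ => 1
  constructor
  rw [logisticMeasure, withDensity_apply _ MeasurableSet.univ]
  simpa [image_sigmoid_div hs, abs_of_nonneg (logisticDensity_nonneg hs 0 _)] using h.symm

/-- Substitute u = sigmoid(x/s). Then 1 - u = sigmoid(-x/s) and x = s log(u/(1 - u)), so exp(itx) =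
u^(its) (1 - u)^(-its). -/
theorem charFun_logisticMeasure {s : ℝ} (hs : 0 < s) (t : ℝ) :
    charFun (logisticMeasure 0 s) t =
      Complex.betaIntegral (1 + t * s * Complex.I) (1 - t * s * Complex.I) := by
  rw [charFun_apply_real, logisticMeasure, integral_withDensity_eq_integral_toReal_smul
    (measurable_logisticDensity 0 s).ennreal_ofReal (by simp), Complex.betaIntegral,
    intervalIntegral.integral_of_le zero_le_one, integral_Ioc_eq_integral_Ioo,
    ← image_sigmoid_div hs, integral_image_eq_integral_abs_deriv_smul MeasurableSet.univ
    (fun x _ => (hasDerivAt_sigmoid_div s x).hasDerivWithinAt)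
    (sigmoid_div_injective hs).injOn, setIntegral_univ]
  refine integral_congr_ae (ae_of_all _ fun x => ?_)
  have hpos := Real.sigmoid_pos (x / s)
  have hneg := Real.sigmoid_pos (-(x / s))
  have hlog : Real.log (Real.sigmoid (x / s)) - Real.log (Real.sigmoid (-(x / s))) = x / s := by
    rw [← Real.sigmoid_mul_rexp_neg, Real.log_mul hpos.ne' (Real.exp_pos _).ne', Real.log_exp]
    ring
  dsimp only
  rw [ENNReal.toReal_ofReal (logisticDensity_nonneg hs 0 x),
    abs_of_nonneg (logisticDensity_nonneg hs 0 x), ← Complex.ofReal_one, ← Complex.ofReal_sub,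
    ← Real.sigmoid_neg, Complex.cpow_def_of_ne_zero (by exact_mod_cast hpos.ne'),
    Complex.cpow_def_of_ne_zero (by exact_mod_cast hneg.ne'), ← Complex.exp_add,
    ← Complex.ofReal_log hpos.le, ← Complex.ofReal_log hneg.le]
  congr 2
  have hx : (x : ℂ) = s * (Real.log (Real.sigmoid (x / s)) -
      Real.log (Real.sigmoid (-(x / s))) : ℝ) := by
    rw [hlog, ← Complex.ofReal_mul, mul_div_cancel₀ _ hs.ne']
  conv_lhs => rw [hx]
  push_cast
  ring

theorem betaIntegral_one_add_one_sub {a : ℂ} (ha : a.re = 0) (ha0 : a ≠ 0) :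
    Complex.betaIntegral (1 + a) (1 - a) = Real.pi * a / Complex.sin (Real.pi * a) := by
  have h := Complex.Gamma_mul_Gamma_eq_betaIntegral (s := 1 + a) (t := 1 - a)
    (by simp [ha]) (by simp [ha])
  rw [show (1 + a + (1 - a) : ℂ) = 1 + 1 by ring, Complex.Gamma_add_one 1 one_ne_zero,
    Complex.Gamma_one, one_mul, one_mul, add_comm 1 a,
    Complex.Gamma_add_one a ha0, mul_assoc, Complex.Gamma_mul_Gamma_one_sub] at h
  rw [add_comm, ← h]
  ring

theorem sin_pi_mul_ne_zero_of_re_eq_zero {a : ℂ} (ha : a.re = 0) (ha0 : a ≠ 0) :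
    Complex.sin (Real.pi * a) ≠ 0 := by
  rw [Complex.sin_ne_zero_iff]
  intro k hk
  have h1 : a = k := by
    have : (Real.pi : ℂ) ≠ 0 := by exact_mod_cast Real.pi_ne_zero
    exact mul_left_cancel₀ this (hk.trans (mul_comm _ _))
  rw [h1] at ha ha0
  exact ha0 (by exact_mod_cast ha)

theorem tendsto_prod_charFun_logisticMeasure {s : ℝ} (hs : 0 < s) (t : ℝ) :
    Tendsto (fun n : ℕ => ∏ k ∈ Finset.range n, (1 : ℂ) / (1 + (t * s / (k + 1)) ^ 2)) atTop
      (𝓝 (charFun (logisticMeasure 0 s) t)) := by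
  have := isProbabilityMeasure_logisticMeasure hs
  -- At `t = 0` the quotient πa / sin(πa) degenerates to 0/0.
  rcases eq_or_ne t 0 with rfl | ht
  · simp
  set a : ℂ := t * s * Complex.I with ha
  have hre : a.re = 0 := by simp [ha]
  have ha0 : a ≠ 0 := by simp [ha, ht, hs.ne']
  have hpi : (Real.pi * a : ℂ) ≠ 0 := mul_ne_zero (by exact_mod_cast Real.pi_ne_zero) ha0
  rw [charFun_logisticMeasure hs, ← ha, betaIntegral_one_add_one_sub hre ha0]
  refine ((tendsto_const_nhds (x := (Real.pi * a : ℂ))).div (Complex.tendsto_euler_sin_prod a)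
    (sin_pi_mul_ne_zero_of_re_eq_zero hre ha0)).congr fun n => ?_
  rw [Pi.div_apply, div_mul_cancel_left₀ hpi, ← Finset.prod_inv_distrib]
  refine Finset.prod_congr rfl fun k _ => ?_
  rw [one_div, ha, mul_pow _ Complex.I, Complex.I_sq, div_pow]
  ring

theorem logisticDensity_eq_sech (x : ℝ) :
    logisticDensity 0 (1 / (2 * Real.pi)) x = Real.pi / 2 * sech (Real.pi * x) ^ 2 := by
  have hpi := Real.pi_pos
  have h : -(x - 0) / (1 / (2 * Real.pi)) = -(Real.pi * x) + -(Real.pi * x) := by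
    field_simp
    ring
  have he : Real.exp (Real.pi * x) * Real.exp (-(Real.pi * x)) = 1 := by
    rw [← Real.exp_add]; simp
  rw [logisticDensity, sech, Real.cosh_eq, h, Real.exp_add]
  have h1 := Real.exp_pos (Real.pi * x)
  have h2 := Real.exp_pos (-(Real.pi * x))
  have h3 : 1 + Real.exp (-(Real.pi * x)) * Real.exp (-(Real.pi * x)) =
      Real.exp (-(Real.pi * x)) * (Real.exp (Real.pi * x) + Real.exp (-(Real.pi * x))) := by
    linear_combination -he
  rw [h3]
  field_simp

/-! ### Passing to the limit and identifying the law. -/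

theorem tendsto_charFun_map_of_ae_tendsto {Ω : Type*} [MeasurableSpace Ω] {P : Measure Ω}
    [IsFiniteMeasure P] {S : ℕ → Ω → ℝ} {L : Ω → ℝ} (hS : ∀ n, AEMeasurable (S n) P)
    (hL : AEMeasurable L P) (h : ∀ᵐ ω ∂P, Tendsto (fun n => S n ω) atTop (𝓝 (L ω))) (t : ℝ) :
    Tendsto (fun n => charFun (P.map (S n)) t) atTop (𝓝 (charFun (P.map L) t)) := by
  have hcont : Continuous fun x : ℝ => Complex.exp (t * x * Complex.I) := by fun_prop
  have hmap : ∀ {f : Ω → ℝ}, AEMeasurable f P →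
      charFun (P.map f) t = ∫ ω, Complex.exp (t * f ω * Complex.I) ∂P := fun hf => by
    rw [charFun_apply_real, integral_map hf hcont.aestronglyMeasurable]
  simp_rw [hmap hL, hmap (hS _)]
  refine tendsto_integral_of_dominated_convergence (fun _ => 1)
    (fun n => hcont.comp_aestronglyMeasurable (hS n).aestronglyMeasurable)
    (integrable_const 1) (fun n => ae_of_all _ fun ω => ?_) ?_
  · rw [← Complex.ofReal_mul, Complex.norm_exp_ofReal_mul_I]
  · filter_upwards [h] with ω hω
    exact (hcont.tendsto _).comp hω

theorem charFun_partialSumL {Ω : Type*} [MeasurableSpace Ω] {P : Measure Ω}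
    {X : ℕ → Ω → ℝ} (hindep : iIndepFun X P) (hlaw : ∀ k, HasLaw (X k) stdLaplaceMeasure P)
    (n : ℕ) (t : ℝ) :
    charFun (P.map (partialSumL X n)) t =
      ∏ k ∈ Finset.range n, (1 : ℂ) / (1 + (t * (1 / (2 * Real.pi) : ℝ) / (k + 1)) ^ 2) := by
  have hfun : partialSumL X n = fun ω => ∑ k ∈ Finset.range n,
      (2 * Real.pi * ((k : ℝ) + 1))⁻¹ * X k ω := by
    ext ω
    simp only [partialSumL, div_eq_inv_mul]
  have hi : iIndepFun (fun (k : ℕ) ω => (2 * Real.pi * ((k : ℝ) + 1))⁻¹ * X k ω) P :=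
    hindep.comp (fun (k : ℕ) x => (2 * Real.pi * ((k : ℝ) + 1))⁻¹ * x) fun k => by fun_prop
  rw [hfun, iIndepFun.charFun_map_fun_finsetSum_eq_prod
    (fun k _ => (hlaw k).aemeasurable.const_mul _) (hi.restrict _), Finset.prod_apply]
  refine Finset.prod_congr rfl fun k _ => ?_
  rw [charFun_map_mul_comp (hlaw k).aemeasurable, (hlaw k).map_eq, charFun_stdLaplaceMeasure]
  push_cast
  congr 3
  rw [mul_inv]
  ring

theorem exists_isSeriesL {Ω : Type*} [MeasurableSpace Ω] {P : Measure Ω} [IsProbabilityMeasure P]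
    {X : ℕ → Ω → ℝ} (hindep : iIndepFun X P) (hlaw : ∀ k, HasLaw (X k) stdLaplaceMeasure P) :
    ∃ L : Ω → ℝ, IsSeriesL P X L := by
  have hL2 : ∀ k, MemLp (X k) 2 P := fun k => by
    have h := memLp_id_stdLaplaceMeasure
    rw [← (hlaw k).map_eq] at h
    exact (memLp_map_measure_iff (by fun_prop) (hlaw k).aemeasurable).mp h
  have hmean : ∀ k, P[X k] = 0 := fun k => by
    rw [(hlaw k).integral_eq, integral_id_stdLaplaceMeasure]
  refine exists_ae_tendsto_sum_of_summable_variance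
    (Y := fun k ω => X k ω / (2 * Real.pi * ((k : ℝ) + 1)))
    (hindep.comp (fun k x => x / (2 * Real.pi * ((k : ℝ) + 1))) fun k => by fun_prop)
    (fun k => by simpa only [div_eq_mul_inv] using (hL2 k).mul_const _)
    (fun k => by rw [integral_div, hmean k, zero_div]) ?_
  have hvar : ∀ k : ℕ, Var[fun ω => X k ω / (2 * Real.pi * ((k : ℝ) + 1)); P] =
      (1 / ((k + 1 : ℕ) : ℝ) ^ 2) * (Var[id; stdLaplaceMeasure] * ((2 * Real.pi)⁻¹) ^ 2) :=
    fun k => by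
      simp only [div_eq_mul_inv]
      rw [variance_mul_const, (hlaw k).variance_eq, mul_inv, mul_pow, inv_pow ((k : ℝ) + 1)]
      push_cast
      ring
  simp_rw [hvar]
  exact ((summable_nat_add_iff 1).mpr
    (Real.summable_one_div_nat_pow.mpr one_lt_two)).mul_right _

theorem hasLaw_logisticMeasure_of_isSeriesL {Ω : Type*} [MeasurableSpace Ω] {P : Measure Ω}
    [IsProbabilityMeasure P] {X : ℕ → Ω → ℝ} (hindep : iIndepFun X P)
    (hlaw : ∀ k, HasLaw (X k) stdLaplaceMeasure P) {L : Ω → ℝ} (hL : IsSeriesL P X L) :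
    HasLaw L (logisticMeasure 0 (1 / (2 * Real.pi))) P := by
  have hs : 0 < 1 / (2 * Real.pi) := by positivity
  have hS : ∀ n, AEMeasurable (partialSumL X n) P := fun n =>
    Finset.aemeasurable_fun_sum _ fun k _ => (hlaw k).aemeasurable.div_const _
  -- `L` is an arbitrary function; its measurability comes from being an almost sure limit.
  have hLm : AEMeasurable L P := aemeasurable_of_tendsto_metrizable_ae atTop hS hL
  have := isProbabilityMeasure_logisticMeasure hs
  refine ⟨hLm, Measure.ext_of_charFun (funext fun t => ?_)⟩
  refine tendsto_nhds_unique (tendsto_charFun_map_of_ae_tendsto hS hLm hL t) ?_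
  simp_rw [charFun_partialSumL hindep hlaw]
  exact tendsto_prod_charFun_logisticMeasure hs t

theorem mainTheorem1 {Ω : Type*} [MeasurableSpace Ω] (P : Measure Ω) [IsProbabilityMeasure P]
    (X : ℕ → Ω → ℝ) (hindep : iIndepFun X P) (hlaw : ∀ k, HasLaw (X k) stdLaplaceMeasure P) :
    (∃ L : Ω → ℝ, IsSeriesL P X L) ∧
    ∀ L : Ω → ℝ, IsSeriesL P X L →
      HasLaw L (logisticMeasure 0 (1 / (2 * Real.pi))) P ∧
      HasLaw L (volume.withDensity fun x => ENNReal.ofReal (Real.pi / 2 * sech (Real.pi * x) ^ 2))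
        P := by
  refine ⟨exists_isSeriesL hindep hlaw, fun L hL => ?_⟩
  have h := hasLaw_logisticMeasure_of_isSeriesL hindep hlaw hL
  refine ⟨h, ?_⟩
  simpa only [logisticMeasure, logisticDensity_eq_sech] using h
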